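/- Let $X_1,X_2,\dots$ be i.i.d. standard exponential random variables, $S_i=X_1+\dots+X_i$, and $Y_k=\frac{2}{k(k+1)}\sum_{i=1}^k S_i$. Then $(Y_1,\dots,Y_n)^\top=A_n(X_1,\dots,X_n)^\top$, where $A_n$ is the lower triangular $n\times n$ matrix with entries $(A_n)_{ij}=\frac{2(i-j+1)}{i(i+1)}$ for $j\le i$. Put $L_n=A_n^{-1}$ and let $$p_n(\mathbf y)=|\det L_n|\,\prod_{i=1}^n e^{-(L_n\mathbf y)_i}\,\mathbb I_{\{(L_n\mathbf y)_i\ge 0\}},\qquad \mathbf y\in\mathbb R^n,$$ be the density of $(Y_1,\dots,Y_n)$. For $1\le k\le n$ and $t\in\mathbb R$ define the $k$-th partial density of $\min_{1\le i\le n}Y_i$ by $$g_n^{(k)}(t)=\int_{\{\mathbf y\in\mathbb R^n:\ y_i\ge t\ (1\le i\le n),\ y_k=t\}}p_n(\mathbf y)\,d\lambda_{n-1}(\mathbf y),$$ where $\lambda_{n-1}$ is the $(n-1)$-dimensional Lebesgue measure on the hyperplane $\{y_k=t\}$. Then there are positive constants $c_k$, $k\ge 1$, such that for every $n\ge 2$,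 every $1\le k\le n-1$ and every $t\in\mathbb R$ the integral defining $g_n^{(k)}(t)$ is finite and $$g_n^{(k)}(t)=c_k\,\bigl(te^{-t}\bigr)^{k-1}g_{n-k+1}^{(1)}(t)$$ (with $0^0=1$). Moreover, $c_k=O\bigl(\sqrt k\,e^k\bigr)$ as $k\to\infty$. -/

import Mathlib

open MeasureTheory ProbabilityTheory Matrix

/-- The `n × n` matrix `A_n` taking the increments `(x_1, …, x_n)` of a walk
`s_i = x_1 + ⋯ + x_i` to its normalized areas `y_k = 2 / (k (k + 1)) * (s_1 + ⋯ + s_k)`.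
The one-based index of `i : Fin n` is `i + 1`, so the entry in row `k` and column `j ≤ k`
(one-based) is `2 (k - j + 1) / (k (k + 1))`; see `areaMatrix_mulVec`. -/
noncomputable def areaMatrix (n : ℕ) : Matrix (Fin n) (Fin n) ℝ :=
  Matrix.of fun i j =>
    if j ≤ i then 2 * ((i : ℝ) - (j : ℝ) + 1) / (((i : ℝ) + 1) * ((i : ℝ) + 2)) else 0

/-- The joint density `p(y) = |det A_n⁻¹| p_X(A_n⁻¹ y)` of `Y_n = A_n X_n`, where
`p_X(x) = ∏ i, e^{-x_i} 1_{x_i ≥ 0}` is the density of the vector `X_n` of `n` independent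
standard exponential random variables; see `map_normalizedArea`. -/
noncomputable def areaDensity (n : ℕ) (y : Fin n → ℝ) : ℝ :=
  |((areaMatrix n)⁻¹).det| * ∏ i, exponentialPDFReal 1 (((areaMatrix n)⁻¹ *ᵥ y) i)

/-- The coordinates of a point of the hyperplane `{y ∈ ℝⁿ : y_k = t}` (with `k` one-based) other
than the `k`-th. -/
abbrev SliceCoord (n k : ℕ) : Type := {i : Fin n // (i : ℕ) + 1 ≠ k}

/-- The point of the hyperplane `{y ∈ ℝⁿ : y_k = t}` (with `k` one-based) whose other coordinates
are given by `z`. -/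
def slicePoint (n k : ℕ) (t : ℝ) (z : SliceCoord n k → ℝ) : Fin n → ℝ :=
  fun i => if h : (i : ℕ) + 1 ≠ k then z ⟨i, h⟩ else t

/-- The set `{y : y ≥ t 𝟏, y_k = t}` in the coordinates of the hyperplane `y_k = t`. -/
def sliceSet (n k : ℕ) (t : ℝ) : Set (SliceCoord n k → ℝ) :=
  {z | ∀ i, t ≤ slicePoint n k t z i}

/-- The `k`-th partial density `g_n^{(k)}(t)` (with `1 ≤ k ≤ n`) of `min (Y_1, …, Y_n)`: the
integral of the density of `(Y_1, …, Y_n)` over `{y : y ≥ t 𝟏, y_k = t}` with respect to the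
`(n-1)`-dimensional Lebesgue measure. -/
noncomputable def partialDensity (n k : ℕ) (t : ℝ) : ℝ :=
  ∫ z in sliceSet n k t, areaDensity n (slicePoint n k t z)

/-- The normalized areas of the walk with increments `x`. -/
theorem areaMatrix_mulVec (n : ℕ) (x : Fin n → ℝ) (k : Fin n) :
    (areaMatrix n *ᵥ x) k =
      2 / (((k : ℝ) + 1) * ((k : ℝ) + 2)) * ∑ i ∈ Finset.Iic k, ∑ j ∈ Finset.Iic i, x j := by
  have h1 : ∑ i ∈ Finset.Iic k, ∑ j ∈ Finset.Iic i, x j =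
      ∑ j ∈ Finset.Iic k, ∑ i ∈ Finset.Icc j k, x j := by
    apply Finset.sum_comm'
    intro i j
    simp only [Finset.mem_Iic, Finset.mem_Icc]
    constructor
    · rintro ⟨h, h'⟩
      exact ⟨⟨h', h⟩, h'.trans h⟩
    · rintro ⟨⟨h, h'⟩, _⟩
      exact ⟨h', h⟩
  rw [h1, Finset.mul_sum]
  simp only [Matrix.mulVec, dotProduct, areaMatrix, Matrix.of_apply, ite_mul, zero_mul]
  rw [← Finset.sum_filter]
  have h2 : (Finset.univ.filter fun j => j ≤ k) = Finset.Iic k := by ext; simp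
  rw [h2]
  refine Finset.sum_congr rfl fun j hj => ?_
  have hjk : (j : ℕ) ≤ (k : ℕ) := by simpa using hj
  rw [Finset.sum_const, Fin.card_Icc, nsmul_eq_mul, Nat.cast_sub (by omega)]
  push_cast
  ring

theorem areaMatrix_det_ne_zero (n : ℕ) : (areaMatrix n).det ≠ 0 := by
  have h : (areaMatrix n).IsLowerTriangular := by
    intro i j hij
    have : ¬ j ≤ i := not_le.mpr (by simpa using hij)
    simp [areaMatrix, this]
  rw [Matrix.det_of_isLowerTriangular _ h]
  refine Finset.prod_ne_zero_iff.mpr fun i _ => ?_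
  simp only [areaMatrix, Matrix.of_apply, le_refl, if_true, sub_self]
  positivity

theorem lintegral_fin_prod (n : ℕ) (f : Fin n → ℝ → ENNReal) (hf : ∀ i, Measurable (f i)) :
    ∫⁻ x : Fin n → ℝ, ∏ i, f i (x i) = ∏ i, ∫⁻ a, f i a := by
  induction n with
  | zero => simp [volume_pi]
  | succ n ih =>
    have e := (volume_preserving_piFinSuccAbove (fun _ : Fin (n + 1) => ℝ) 0).symm
    rw [← e.lintegral_comp (by fun_prop)]
    simp only [Fin.prod_univ_succ]
    rw [← ih (fun i => f i.succ) fun i => hf _, Measure.volume_eq_prod,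
      ← lintegral_prod_mul (hf 0).aemeasurable (Finset.measurable_fun_prod _
        fun i _ => (hf i.succ).comp (measurable_pi_apply i)).aemeasurable]
    rfl

theorem pi_expMeasure (n : ℕ) :
    Measure.pi (fun _ : Fin n => expMeasure 1) =
      volume.withDensity fun x : Fin n → ℝ => ∏ i, exponentialPDF 1 (x i) := by
  have hm : Measurable (exponentialPDF 1) := (measurable_exponentialPDFReal 1).ennreal_ofReal
  have := isProbabilityMeasure_expMeasure one_pos
  refine Measure.pi_eq fun s hs => ?_
  rw [withDensity_apply _ (MeasurableSet.univ_pi hs),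
    ← lintegral_indicator (MeasurableSet.univ_pi hs)]
  have h1 : (Set.univ.pi s).indicator (fun x : Fin n → ℝ => ∏ i, exponentialPDF 1 (x i)) =
      fun x => ∏ i, (s i).indicator (exponentialPDF 1) (x i) := by
    ext x
    by_cases hx : x ∈ Set.univ.pi s
    · rw [Set.indicator_of_mem hx]
      exact Finset.prod_congr rfl fun i _ => (Set.indicator_of_mem (hx i (Set.mem_univ i)) _).symm
    · rw [Set.indicator_of_notMem hx]
      obtain ⟨i, hi⟩ : ∃ i, x i ∉ s i := by simpa [Set.mem_univ_pi] using hx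
      exact (Finset.prod_eq_zero (Finset.mem_univ i) (Set.indicator_of_notMem hi _)).symm
  rw [h1, lintegral_fin_prod n (fun i => (s i).indicator (exponentialPDF 1))
    fun i => hm.indicator (hs i)]
  refine Finset.prod_congr rfl fun i _ => ?_
  rw [lintegral_indicator (hs i), expMeasure, gammaMeasure, withDensity_apply _ (hs i)]
  rfl

/-- `areaDensity n` is the density of the law of `(Y_1, …, Y_n)`. -/
theorem map_normalizedArea {Ω : Type*} [MeasurableSpace Ω] (P : Measure Ω)
    [IsProbabilityMeasure P] (n : ℕ) (X : Fin n → Ω → ℝ) (hX : ∀ i, Measurable (X i))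
    (hlaw : ∀ i, P.map (X i) = expMeasure 1) (hind : iIndepFun X P) :
    P.map (fun ω => areaMatrix n *ᵥ fun i => X i ω) =
      volume.withDensity fun y => ENNReal.ofReal (areaDensity n y) := by
  have hm : Measurable (exponentialPDF 1) := (measurable_exponentialPDFReal 1).ennreal_ofReal
  have hA : Measurable fun x : Fin n → ℝ => areaMatrix n *ᵥ x :=
    (Matrix.toLin' (areaMatrix n)).continuous_of_finiteDimensional.measurable
  have hL : Measurable fun x : Fin n → ℝ => (areaMatrix n)⁻¹ *ᵥ x :=
    (Matrix.toLin' (areaMatrix n)⁻¹).continuous_of_finiteDimensional.measurable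
  have hXm : Measurable fun ω i => X i ω := measurable_pi_lambda _ hX
  have hlawX : P.map (fun ω i => X i ω) = Measure.pi fun _ : Fin n => expMeasure 1 := by
    rw [(iIndepFun_iff_map_fun_eq_pi_map fun i => (hX i).aemeasurable).mp hind]
    simp only [hlaw]
  have hdet := areaMatrix_det_ne_zero n
  have hvol := Real.map_matrix_volume_pi_eq_smul_volume_pi hdet
  have hp : (fun y => ENNReal.ofReal (areaDensity n y)) = fun y =>
      ENNReal.ofReal |(areaMatrix n).det⁻¹| *
        ∏ i, exponentialPDF 1 (((areaMatrix n)⁻¹ *ᵥ y) i) := by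
    ext y
    rw [areaDensity, ENNReal.ofReal_mul (abs_nonneg _),
      ENNReal.ofReal_prod_of_nonneg fun i _ => exponentialPDFReal_nonneg one_pos _,
      Matrix.det_nonsing_inv, Ring.inverse_eq_inv']
    rfl
  have hF : Measurable fun y : Fin n → ℝ =>
      ∏ i, exponentialPDF 1 (((areaMatrix n)⁻¹ *ᵥ y) i) := by fun_prop
  have h1 : P.map (fun ω => areaMatrix n *ᵥ fun i => X i ω) =
      (P.map fun ω i => X i ω).map fun x => areaMatrix n *ᵥ x :=
    (Measure.map_map hA hXm).symm
  rw [h1, hlawX, pi_expMeasure]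
  ext s hs
  rw [Measure.map_apply hA hs, withDensity_apply _ (hA hs), withDensity_apply _ hs, hp,
    lintegral_const_mul _ hF, ← smul_eq_mul, ← lintegral_smul_measure, ← Measure.restrict_smul,
    ← hvol, setLIntegral_map hs hF (by exact hA)]
  refine lintegral_congr fun x => ?_
  rw [Matrix.toLin'_apply, Matrix.mulVec_mulVec,
    Matrix.nonsing_inv_mul _ (isUnit_iff_ne_zero.mpr hdet), Matrix.one_mulVec]

open scoped fwdDiff

/-!
Fix a level `t` and describe the walk by its excess areas `W i = triangular i * (y i - t)`, where
`triangular i = (i + 1) * (i + 2) / 2`. The increments of the walk are then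
`t + Δ² (0, 0, W 0, W 1, …)`, so the density of the normalized areas on the event that all of them
are at least `t` is, up to scaling, `exp` of minus the sum of the increments on the region where
`W ≥ 0` and all second differences are at least `-t`.

On the slice `y_k = t` one entry of `W` vanishes. The second difference centred there is a sum of
two nonnegative terms, hence imposes no condition, and every other one sees only the entries before
or only those after. The past and the future decouple. The sum of the increments telescopes to
`n * t` and a boundary term that depends on the future alone. So the past contributes the volume of
a region of dimension `k - 1`, which is homogeneous of degree `k - 1` in `t`, and the future
contributes a factor that depends only on `n - k` and `t`.

The increments of the past are obtained from its `W` by a translate of the Dirichlet Laplacian, of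
determinant `±k`, and they form a point of a simplex of size `(k - 1) * t`. This bounds the volume
by `((k - 1) * t) ^ (k - 1) / k!`, and Stirling's formula gives `c_k = O(√k * exp k)`.
-/

section SecondDifference

variable {R : Type*} [CommRing R]

theorem fwdDiff_fwdDiff_one_apply (f : ℕ → R) (j : ℕ) :
    Δ_[1] (Δ_[1] f) j = f (j + 2) - 2 * f (j + 1) + f j := by
  simp only [fwdDiff]
  ring

theorem sum_range_mul_fwdDiff_fwdDiff (f : ℕ → R) (n : ℕ) :
    ∑ j ∈ Finset.range n, ((j : R) + 1) * Δ_[1] (Δ_[1] f) (j + 1) =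
      n * f (n + 2) - (n + 1) * f (n + 1) + f 1 := by
  induction n with
  | zero => simp
  | succ n ih =>
    rw [Finset.sum_range_succ, ih, fwdDiff_fwdDiff_one_apply]
    push_cast
    ring

/-- The sequence `0, 0, f 0, …, f (n - 1), 0, 0, …`. Its two leading zeros are the initial values
that turn every increment of a walk, the first two included, into a second difference of the
partial sums of the walk. -/
noncomputable def zeroPad (n : ℕ) : (Fin n → R) →ₗ[R] (ℕ → R) :=
  Function.ExtendByZero.linearMap R fun i : Fin n => (i : ℕ) + 2

variable {n : ℕ}

theorem zeroPad_eq_extend (f : Fin n → R) :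
    zeroPad n f = Function.extend (fun i : Fin n => (i : ℕ) + 2) f 0 := rfl

theorem zeroPad_add_two (f : Fin n → R) {i : ℕ} (hi : i < n) :
    zeroPad n f (i + 2) = f ⟨i, hi⟩ := by
  have hinj : Function.Injective fun i : Fin n => (i : ℕ) + 2 :=
    fun _ _ h => Fin.ext (Nat.add_right_cancel h)
  exact hinj.extend_apply f 0 ⟨i, hi⟩

theorem zeroPad_of_lt_two (f : Fin n → R) {j : ℕ} (hj : j < 2) : zeroPad n f j = 0 := by
  rw [zeroPad_eq_extend, Function.extend_apply' _ _ _ (by rintro ⟨i, hi⟩; omega), Pi.zero_apply]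

theorem zeroPad_of_add_two_le (f : Fin n → R) {j : ℕ} (hj : n + 2 ≤ j) : zeroPad n f j = 0 := by
  rw [zeroPad_eq_extend, Function.extend_apply' _ _ _ (by rintro ⟨i, hi⟩; omega), Pi.zero_apply]

@[simp]
theorem zeroPad_zero (f : Fin n → R) : zeroPad n f 0 = 0 :=
  zeroPad_of_lt_two f two_pos

@[simp]
theorem zeroPad_one (f : Fin n → R) : zeroPad n f 1 = 0 :=
  zeroPad_of_lt_two f one_lt_two

theorem sum_fwdDiff_fwdDiff_zeroPad (f : Fin n → R) (m : ℕ) :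
    ∑ j ∈ Finset.range m, Δ_[1] (Δ_[1] (zeroPad n f)) j = Δ_[1] (zeroPad n f) m := by
  have hsum := Finset.sum_range_sub (Δ_[1] (zeroPad n f)) m
  rwa [show Δ_[1] (zeroPad n f) 0 = 0 by simp [fwdDiff], sub_zero] at hsum

theorem sum_fwdDiff_zeroPad (f : Fin n → R) (m : ℕ) :
    ∑ j ∈ Finset.range m, Δ_[1] (zeroPad n f) (j + 1) = zeroPad n f (m + 1) := by
  have hsum := Finset.sum_range_sub (fun j => zeroPad n f (j + 1)) m
  rwa [zero_add, zeroPad_one, sub_zero] at hsum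

theorem zeroPad_nonneg {f : Fin n → ℝ} (hf : 0 ≤ f) : 0 ≤ zeroPad n f :=
  Function.extend_nonneg hf le_rfl

theorem zeroPad_le {f : Fin n → ℝ} {C : ℝ} (hC : 0 ≤ C) (hf : ∀ i, f i ≤ C) (j : ℕ) :
    zeroPad n f j ≤ C := by
  rw [zeroPad_eq_extend, Function.extend_def]
  split_ifs
  exacts [hf _, hC]

@[fun_prop]
theorem continuous_zeroPad_apply (n j : ℕ) : Continuous fun f : Fin n → ℝ => zeroPad n f j :=
  (continuous_apply j).comp (zeroPad (R := ℝ) n).continuous_of_finiteDimensional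

/-- The discrete Laplacian on `n` points with zero boundary values: the second differences of
`0, f 0, …, f (n - 1), 0` around its inner terms. -/
noncomputable def dirichletLaplacian (n : ℕ) : (Fin n → R) →ₗ[R] (Fin n → R) where
  toFun f i := Δ_[1] (Δ_[1] (zeroPad n f)) (i + 1)
  map_add' f g := by ext; simp
  map_smul' c f := by ext; simp

theorem dirichletLaplacian_apply (f : Fin n → R) (i : Fin n) :
    dirichletLaplacian n f i = Δ_[1] (Δ_[1] (zeroPad n f)) (i + 1) := rfl

/-- The matrix of the sums `∑ j ≤ i, (j + 1) * f j`, the inverse of the lower triangular factor of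
the Dirichlet Laplacian. -/
def ascendingSumMatrix (R : Type*) [CommRing R] (n : ℕ) : Matrix (Fin n) (Fin n) R :=
  Matrix.of fun i j => if j ≤ i then (j : R) + 1 else 0

theorem det_ascendingSumMatrix (n : ℕ) : (ascendingSumMatrix R n).det = n.factorial := by
  have hlower : (ascendingSumMatrix R n).IsLowerTriangular := fun i j hij =>
    if_neg (not_le.mpr (OrderDual.toDual_lt_toDual.mp hij))
  rw [Matrix.det_of_isLowerTriangular _ hlower, ← Finset.prod_range_add_one_eq_factorial,
    ← Fin.prod_univ_eq_prod_range (· + 1) n]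
  simp [ascendingSumMatrix]

theorem sum_Iic_fin {M : Type*} [AddCommMonoid M] (F : ℕ → M) (i : Fin n) :
    ∑ j ∈ Finset.Iic i, F j = ∑ j ∈ Finset.range (i + 1), F j := by
  rw [← Nat.Iio_eq_range, Finset.Iio_add_one_eq_Iic, ← Fin.map_valEmbedding_Iic, Finset.sum_map]
  rfl

theorem ascendingSumMatrix_mulVec_dirichletLaplacian (f : Fin n → R) (i : Fin n) :
    (ascendingSumMatrix R n *ᵥ dirichletLaplacian n f) i =
      (i + 1) * zeroPad n f (i + 3) - (i + 2) * f i := by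
  calc (ascendingSumMatrix R n *ᵥ dirichletLaplacian n f) i
      = ∑ j ∈ Finset.Iic i, ((j : R) + 1) * Δ_[1] (Δ_[1] (zeroPad n f)) (j + 1) := by
        simp [ascendingSumMatrix, Matrix.mulVec, dotProduct, dirichletLaplacian_apply,
          ← Finset.sum_filter, Finset.filter_ge_eq_Iic]
    _ = (i + 1) * zeroPad n f (i + 3) - (i + 2) * f i := by
        rw [sum_Iic_fin (fun j => ((j : R) + 1) * Δ_[1] (Δ_[1] (zeroPad n f)) (j + 1)),
          sum_range_mul_fwdDiff_fwdDiff, zeroPad_one, add_assoc (i : ℕ) 1 1, one_add_one_eq_two,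
          zeroPad_add_two f i.2]
        push_cast
        ring

theorem det_ascendingSumMatrix_mul_dirichletLaplacian (n : ℕ) :
    LinearMap.det (Matrix.toLin' (ascendingSumMatrix R n) ∘ₗ dirichletLaplacian n) =
      (-1) ^ n * (n + 1).factorial := by
  set B := Matrix.toLin' (ascendingSumMatrix R n) ∘ₗ dirichletLaplacian n
  have hentry (i j : Fin n) : LinearMap.toMatrix' B i j =
      (i + 1) * zeroPad n (Pi.single j 1) (i + 3) - (i + 2) * (Pi.single j 1 : Fin n → R) i := by
    rw [LinearMap.toMatrix'_apply]
    exact ascendingSumMatrix_mulVec_dirichletLaplacian _ i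
  have hsuper {i j : Fin n} (hji : j ≤ i) : zeroPad n (Pi.single j 1 : Fin n → R) (i + 3) = 0 := by
    rcases lt_or_ge ((i : ℕ) + 1) n with hi | hi
    · rw [zeroPad_add_two _ hi, Pi.single_eq_of_ne (Fin.ne_of_gt (Nat.lt_succ_of_le hji))]
    · exact zeroPad_of_add_two_le _ (by omega)
  have hupper : (LinearMap.toMatrix' B).IsUpperTriangular := by
    intro i j (hji : j < i)
    rw [hentry, hsuper hji.le, Pi.single_eq_of_ne hji.ne', mul_zero, mul_zero, sub_zero]
  rw [← LinearMap.det_toMatrix', Matrix.det_of_isUpperTriangular hupper]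
  calc ∏ i, LinearMap.toMatrix' B i i = ∏ i : Fin n, -((i : R) + 2) := by
        simp only [hentry, hsuper le_rfl, Pi.single_eq_same, mul_zero, mul_one, zero_sub]
    _ = (-1) ^ n * (n + 1).factorial := by
        rw [Finset.prod_neg, Finset.card_univ, Fintype.card_fin,
          ← Finset.prod_range_add_one_eq_factorial, Finset.prod_range_succ', zero_add, mul_one,
          ← Fin.prod_univ_eq_prod_range (fun i => i + 1 + 1) n]
        push_cast
        simp only [add_assoc, one_add_one_eq_two]

theorem det_dirichletLaplacian {K : Type*} [Field K] [CharZero K] (n : ℕ) :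
    LinearMap.det (dirichletLaplacian (R := K) n) = (-1) ^ n * (n + 1) := by
  have hfactorial : (n.factorial : K) ≠ 0 := Nat.cast_ne_zero.mpr n.factorial_ne_zero
  have hdet := det_ascendingSumMatrix_mul_dirichletLaplacian (R := K) n
  rw [LinearMap.det_comp, LinearMap.det_toLin', det_ascendingSumMatrix, Nat.factorial_succ] at hdet
  refine mul_left_cancel₀ hfactorial (hdet.trans ?_)
  push_cast
  ring

end SecondDifference

section Simplex

/-- The corner simplex `{x | 0 ≤ x, x_1 + ⋯ + x_n ≤ s}`. -/
def cornerSimplex (n : ℕ) (s : ℝ) : Set (Fin n → ℝ) :=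
  {x | 0 ≤ x ∧ ∑ i, x i ≤ s}

theorem measurableSet_cornerSimplex (n : ℕ) (s : ℝ) : MeasurableSet (cornerSimplex n s) :=
  measurableSet_Ici.inter (measurableSet_le
    (Finset.measurable_fun_sum _ fun i _ => measurable_pi_apply i) measurable_const)

theorem cornerSimplex_eq_empty (n : ℕ) {s : ℝ} (hs : s < 0) : cornerSimplex n s = ∅ :=
  Set.eq_empty_of_forall_notMem fun _ ⟨hx, hxs⟩ =>
    hs.not_ge ((Finset.sum_nonneg fun i _ => hx i).trans hxs)

theorem cons_mem_cornerSimplex {n : ℕ} {s r : ℝ} {x : Fin n → ℝ} :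
    (Fin.cons r x : Fin (n + 1) → ℝ) ∈ cornerSimplex (n + 1) s ↔
      0 ≤ r ∧ x ∈ cornerSimplex n (s - r) := by
  simp [cornerSimplex, Pi.le_def, Fin.forall_fin_succ, Fin.sum_univ_succ, and_assoc,
    le_sub_iff_add_le']

theorem volume_cornerSimplex_succ (n : ℕ) (s : ℝ) :
    volume (cornerSimplex (n + 1) s) =
      ∫⁻ r in Set.Icc 0 s, volume (cornerSimplex n (s - r)) := by
  have hcons := (volume_preserving_piFinSuccAbove (fun _ : Fin (n + 1) => ℝ) 0).symm
  have hsimplex := measurableSet_cornerSimplex (n + 1) s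
  rw [← hcons.measure_preimage hsimplex.nullMeasurableSet, Measure.volume_eq_prod,
    Measure.prod_apply (hcons.measurable hsimplex), ← lintegral_indicator measurableSet_Icc]
  refine lintegral_congr fun r => ?_
  have hsection : Prod.mk r ⁻¹' ((MeasurableEquiv.piFinSuccAbove
      (fun _ : Fin (n + 1) => ℝ) 0).symm ⁻¹' cornerSimplex (n + 1) s) =
        {x | 0 ≤ r ∧ x ∈ cornerSimplex n (s - r)} := by
    ext x
    rw [Set.mem_preimage, Set.mem_preimage, MeasurableEquiv.piFinSuccAbove_symm_apply,
      Fin.insertNthEquiv_zero]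
    exact cons_mem_cornerSimplex
  rw [hsection]
  by_cases hr : r ∈ Set.Icc 0 s
  · simp [Set.indicator_of_mem hr, hr.1]
  · rw [Set.indicator_of_notMem hr]
    rcases lt_or_ge r 0 with hr0 | hr0
    · simp [hr0.not_ge]
    · have hrs : s - r < 0 := sub_neg.mpr (not_le.mp fun hrs => hr ⟨hr0, hrs⟩)
      simp [cornerSimplex_eq_empty n hrs]

theorem volume_cornerSimplex (n : ℕ) {s : ℝ} (hs : 0 ≤ s) :
    volume (cornerSimplex n s) = ENNReal.ofReal (s ^ n / n.factorial) := by
  induction n generalizing s with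
  | zero =>
    have huniv : cornerSimplex 0 s = Set.univ :=
      Set.eq_univ_of_forall fun _ => ⟨fun i => i.elim0, by simpa using hs⟩
    simp [huniv, volume_pi]
  | succ n ih =>
    have hnonneg : ∀ r ∈ Set.Icc 0 s, 0 ≤ (s - r) ^ n / n.factorial := fun r hr =>
      div_nonneg (pow_nonneg (sub_nonneg.mpr hr.2) n) n.factorial.cast_nonneg
    calc volume (cornerSimplex (n + 1) s)
        = ∫⁻ r in Set.Icc 0 s, ENNReal.ofReal ((s - r) ^ n / n.factorial) := by
          rw [volume_cornerSimplex_succ]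
          exact setLIntegral_congr_fun measurableSet_Icc fun r hr => ih (sub_nonneg.mpr hr.2)
      _ = ENNReal.ofReal (∫ r in Set.Icc 0 s, (s - r) ^ n / n.factorial) := by
          rw [ofReal_integral_eq_lintegral_ofReal
            (Continuous.integrableOn_Icc (by fun_prop))
            ((ae_restrict_iff' measurableSet_Icc).mpr (.of_forall hnonneg))]
      _ = ENNReal.ofReal (s ^ (n + 1) / (n + 1).factorial) := by
          rw [integral_Icc_eq_integral_Ioc, ← intervalIntegral.integral_of_le hs,
            intervalIntegral.integral_div,
            intervalIntegral.integral_comp_sub_left (fun x => x ^ n) s, integral_pow, sub_self,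
            sub_zero, zero_pow n.succ_ne_zero, sub_zero, div_div, Nat.factorial_succ]
          push_cast
          rfl

end Simplex

section SemiconvexRegion

/-- The nonnegative `f` for which the first `m` second differences of the sequence
`0, 0, f 0, …, f (n - 1), 0, …` are at least `-t`. For `m = n` the closing zero is not seen by
these differences, and for `m = n + 1` it is. -/
def semiconvexRegion (n m : ℕ) (t : ℝ) : Set (Fin n → ℝ) :=
  {f | 0 ≤ f ∧ ∀ j < m, -t ≤ Δ_[1] (Δ_[1] (zeroPad n f)) j}

variable {t : ℝ}

theorem measurableSet_semiconvexRegion (n m : ℕ) (t : ℝ) :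
    MeasurableSet (semiconvexRegion n m t) := by
  have hcont (j : ℕ) : Continuous fun f : Fin n → ℝ => Δ_[1] (Δ_[1] (zeroPad n f)) j := by
    simp only [fwdDiff]
    fun_prop
  have hclosed : IsClosed {f : Fin n → ℝ | ∀ j < m, -t ≤ Δ_[1] (Δ_[1] (zeroPad n f)) j} := by
    simp only [Set.ofPred_forall]
    exact isClosed_iInter fun j => isClosed_iInter fun _ => isClosed_le continuous_const (hcont j)
  exact (isClosed_Ici.inter hclosed).measurableSet

theorem semiconvexRegion_zero (m : ℕ) (ht : 0 ≤ t) : semiconvexRegion 0 m t = Set.univ := by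
  refine Set.eq_univ_of_forall fun f => ?_
  rw [Subsingleton.elim f 0]
  refine ⟨le_rfl, fun j _ => ?_⟩
  rw [map_zero]
  simpa [fwdDiff_fwdDiff_one_apply] using ht

theorem volume_semiconvexRegion_pos (n m : ℕ) (ht : 0 < t) :
    0 < volume (semiconvexRegion n m t) := by
  have hsub : Set.univ.pi (fun _ : Fin n => Set.Ioo (0 : ℝ) (t / 2)) ⊆
      semiconvexRegion n m t := by
    intro f hf
    have hf0 : 0 ≤ f := fun i => (hf i trivial).1.le
    have hnonneg (j : ℕ) : 0 ≤ zeroPad n f j := zeroPad_nonneg hf0 j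
    refine ⟨hf0, fun j _ => ?_⟩
    have hle := zeroPad_le (half_pos ht).le (fun i => (hf i trivial).2.le) (j + 1)
    rw [fwdDiff_fwdDiff_one_apply]
    linarith [hnonneg (j + 2), hnonneg j]
  refine (IsOpen.measure_pos volume ?_ ?_).trans_le (measure_mono hsub)
  · exact isOpen_set_pi Set.finite_univ fun _ _ => isOpen_Ioo
  · exact Set.univ_pi_nonempty_iff.mpr fun _ => Set.nonempty_Ioo.mpr (half_pos ht)

-- The increments `t + Δ² f j` are nonnegative, and their sum is at most `n * t` because the
-- second differences of a nonnegative sequence with zero ends telescope to `-f 0 - f (n - 1)`.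
theorem dirichletLaplacian_add_mem_cornerSimplex {n : ℕ} {f : Fin n → ℝ}
    (hf : f ∈ semiconvexRegion n (n + 1) t) :
    (fun _ => t) + dirichletLaplacian n f ∈ cornerSimplex n (n * t) := by
  refine ⟨fun i => neg_le_iff_add_nonneg'.mp (hf.2 (i + 1) (by omega)), ?_⟩
  have hsum := sum_fwdDiff_fwdDiff_zeroPad f (n + 1)
  rw [Finset.sum_range_succ'] at hsum
  have hlast : Δ_[1] (zeroPad n f) (n + 1) = -zeroPad n f (n + 1) := by
    rw [fwdDiff, zeroPad_of_add_two_le f le_rfl, zero_sub]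
  have hsecond : Δ_[1] (Δ_[1] (zeroPad n f)) 0 = zeroPad n f 2 := by
    simp [fwdDiff_fwdDiff_one_apply]
  have hlap : ∑ i, dirichletLaplacian n f i =
      ∑ j ∈ Finset.range n, Δ_[1] (Δ_[1] (zeroPad n f)) (j + 1) :=
    Fin.sum_univ_eq_sum_range (fun j => Δ_[1] (Δ_[1] (zeroPad n f)) (j + 1)) n
  have hnonneg (j : ℕ) : 0 ≤ zeroPad n f j := zeroPad_nonneg hf.1 j
  simp only [Pi.add_apply, Finset.sum_add_distrib, Finset.sum_const, Finset.card_univ,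
    Fintype.card_fin, nsmul_eq_mul]
  linarith [hnonneg 2, hnonneg (n + 1)]

theorem volume_semiconvexRegion_le (n : ℕ) (ht : 0 ≤ t) :
    volume (semiconvexRegion n (n + 1) t) ≤
      ENNReal.ofReal ((n * t) ^ n / (n + 1).factorial) := by
  have hdet : |LinearMap.det (dirichletLaplacian (R := ℝ) n)| = n + 1 := by
    rw [det_dirichletLaplacian, abs_mul, abs_neg_one_pow, one_mul, abs_of_nonneg (by positivity)]
  have himage : ENNReal.ofReal (n + 1) * volume (semiconvexRegion n (n + 1) t) ≤
      ENNReal.ofReal ((n * t) ^ n / n.factorial) := by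
    rw [← hdet, ← Measure.addHaar_image_linearMap, ← volume_cornerSimplex n (by positivity),
      ← measure_preimage_add volume (fun _ => t) (cornerSimplex n (n * t))]
    exact measure_mono (Set.image_subset_iff.mpr fun f hf =>
      dirichletLaplacian_add_mem_cornerSimplex hf)
  have hpos : (0 : ℝ) < n + 1 := by positivity
  rw [show ((n * t) ^ n / (n + 1).factorial : ℝ) = (n * t) ^ n / n.factorial / (n + 1) by
      rw [Nat.factorial_succ]; push_cast; field_simp,
    ENNReal.ofReal_div_of_pos hpos,
    ENNReal.le_div_iff_mul_le (.inl (by simpa using hpos)) (.inl ENNReal.ofReal_ne_top), mul_comm]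
  exact himage

theorem volume_semiconvexRegion_ne_top (n : ℕ) (ht : 0 ≤ t) :
    volume (semiconvexRegion n (n + 1) t) ≠ ⊤ :=
  ((volume_semiconvexRegion_le n ht).trans_lt ENNReal.ofReal_lt_top).ne

open scoped Pointwise in
theorem semiconvexRegion_eq_smul (n m : ℕ) (ht : 0 < t) :
    semiconvexRegion n m t = t • semiconvexRegion n m 1 := by
  ext f
  have hnonneg : 0 ≤ t⁻¹ • f ↔ 0 ≤ f := by
    simp only [Pi.le_def, Pi.zero_apply, Pi.smul_apply, smul_eq_mul,
      mul_nonneg_iff_of_pos_left (inv_pos.mpr ht)]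
  have hscale (x : ℝ) : -1 ≤ t⁻¹ * x ↔ -t ≤ x := by
    rw [inv_mul_eq_div, le_div_iff₀ ht, neg_one_mul]
  simp only [Set.mem_smul_set_iff_inv_smul_mem₀ ht.ne', semiconvexRegion, Set.mem_ofPred_eq,
    map_smul, fwdDiff_const_smul, Pi.smul_apply, smul_eq_mul, hscale, hnonneg]

theorem volume_semiconvexRegion (n : ℕ) (ht : 0 ≤ t) :
    volume (semiconvexRegion n (n + 1) t) =
      ENNReal.ofReal (t ^ n) * volume (semiconvexRegion n (n + 1) 1) := by
  rcases ht.eq_or_lt with rfl | ht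
  · rcases n.eq_zero_or_pos with rfl | hn
    · simp [semiconvexRegion_zero]
    · have hzero := volume_semiconvexRegion_le n le_rfl
      rw [mul_zero, zero_pow hn.ne', zero_div, ENNReal.ofReal_zero, nonpos_iff_eq_zero] at hzero
      rw [hzero, zero_pow hn.ne', ENNReal.ofReal_zero, zero_mul]
  · rw [semiconvexRegion_eq_smul _ _ ht, Measure.addHaar_smul_of_nonneg _ ht.le,
      Module.finrank_fin_fun]

end SemiconvexRegion

section AreaDensity

/-- The `(i + 1)`-st triangular number `(i + 1) * (i + 2) / 2`, by which the normalized area with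
zero-based index `i` has to be multiplied to give the sum of the first `i + 1` partial sums. -/
noncomputable def triangular (i : ℕ) : ℝ :=
  (i + 1) * (i + 2) / 2

theorem triangular_pos (i : ℕ) : 0 < triangular i := by
  unfold triangular
  positivity

theorem prod_triangular_pos {ι : Type*} [Fintype ι] (f : ι → ℕ) : 0 < ∏ i, triangular (f i) :=
  Finset.prod_pos fun i _ => triangular_pos (f i)

variable {n : ℕ} {t : ℝ}

theorem fwdDiff_fwdDiff_zeroPad_triangular {i : ℕ} (hi : i < n) :
    Δ_[1] (Δ_[1] (zeroPad n fun j => triangular j)) i = 1 := by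
  have hpad : ∀ j < n + 2, zeroPad n (fun j => triangular j) j = j * (j - 1) / 2
    | 0, _ => by simp
    | 1, _ => by simp
    | j + 2, hj => by
      rw [zeroPad_add_two _ (Nat.add_lt_add_iff_right.mp hj), triangular]
      push_cast
      ring
  rw [fwdDiff_fwdDiff_one_apply, hpad _ (by omega), hpad _ (by omega), hpad _ (by omega)]
  push_cast
  ring

theorem areaMatrix_inv_mulVec (y : Fin n → ℝ) (i : Fin n) :
    ((areaMatrix n)⁻¹ *ᵥ y) i = Δ_[1] (Δ_[1] (zeroPad n fun j => triangular j * y j)) i := by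
  set E := zeroPad n fun j => triangular j * y j with hE
  have hy : areaMatrix n *ᵥ (fun i : Fin n => Δ_[1] (Δ_[1] E) i) = y := by
    ext k
    have hpartial (i : Fin n) : ∑ j ∈ Finset.Iic i, Δ_[1] (Δ_[1] E) j = Δ_[1] E (i + 1) := by
      rw [sum_Iic_fin, hE, sum_fwdDiff_fwdDiff_zeroPad]
    rw [areaMatrix_mulVec, Finset.sum_congr rfl fun i _ => hpartial i,
      sum_Iic_fin fun i => Δ_[1] E (i + 1), hE, sum_fwdDiff_zeroPad, zeroPad_add_two _ k.2,
      triangular]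
    field_simp
  rw [← hy, Matrix.mulVec_mulVec,
    Matrix.nonsing_inv_mul _ (isUnit_iff_ne_zero.mpr (areaMatrix_det_ne_zero n)),
    Matrix.one_mulVec]

theorem abs_det_areaMatrix_inv (n : ℕ) :
    |((areaMatrix n)⁻¹).det| = ∏ i : Fin n, triangular i := by
  have hlower : (areaMatrix n).IsLowerTriangular := fun i j hij =>
    if_neg (not_le.mpr (OrderDual.toDual_lt_toDual.mp hij))
  have hdiag (i : Fin n) : areaMatrix n i i = (triangular i)⁻¹ := by
    simp [areaMatrix, triangular]
  rw [Matrix.det_nonsing_inv, Ring.inverse_eq_inv', Matrix.det_of_isLowerTriangular _ hlower,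
    ← Finset.prod_inv_distrib]
  simp only [hdiag, inv_inv]
  exact abs_of_pos (prod_triangular_pos _)

theorem prod_exponentialPDFReal {ι : Type*} [Fintype ι] (r : ℝ) (x : ι → ℝ) :
    ∏ i, exponentialPDFReal r (x i) =
      (Set.Ici 0).indicator (fun x => r ^ Fintype.card ι * Real.exp (-(r * ∑ i, x i))) x := by
  have hpdf (x : ℝ) : exponentialPDFReal r x = if 0 ≤ x then r * Real.exp (-(r * x)) else 0 := by
    simp [exponentialPDFReal, gammaPDFReal]
  simp only [hpdf]
  by_cases hx : 0 ≤ x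
  · rw [Set.indicator_of_mem (Set.mem_Ici.mpr hx),
      Finset.prod_congr rfl fun i _ => if_pos (show 0 ≤ x i from hx i), Finset.prod_mul_distrib,
      Finset.prod_const, Finset.card_univ, ← Real.exp_sum,
      Finset.sum_neg_distrib, Finset.mul_sum]
  · obtain ⟨i, hi⟩ : ∃ i, ¬0 ≤ x i := not_forall.mp hx
    rw [Set.indicator_of_notMem (by exact hx),
      Finset.prod_eq_zero (Finset.mem_univ i) (if_neg hi)]

theorem areaDensity_eq_indicator (y : Fin n → ℝ) :
    areaDensity n y = (∏ i : Fin n, triangular i) *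
      (Set.Ici 0).indicator (fun x => Real.exp (-∑ i, x i)) ((areaMatrix n)⁻¹ *ᵥ y) := by
  simp only [areaDensity, abs_det_areaMatrix_inv, prod_exponentialPDFReal, one_pow, one_mul]

theorem areaDensity_nonneg (y : Fin n → ℝ) : 0 ≤ areaDensity n y :=
  mul_nonneg (abs_nonneg _) (Finset.prod_nonneg fun _ _ => exponentialPDFReal_nonneg one_pos _)

theorem measurable_areaDensity (n : ℕ) : Measurable (areaDensity n) := by
  have hinv : Measurable fun y : Fin n → ℝ => (areaMatrix n)⁻¹ *ᵥ y :=
    (Matrix.toLin' (areaMatrix n)⁻¹).continuous_of_finiteDimensional.measurable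
  exact (Finset.measurable_fun_prod _ fun i _ => (measurable_exponentialPDFReal 1).comp
    ((measurable_pi_apply i).comp hinv)).const_mul _

theorem areaDensity_of_neg {y : Fin n → ℝ} {k : Fin n} (hk : y k < 0) : areaDensity n y = 0 := by
  have hy : areaMatrix n *ᵥ ((areaMatrix n)⁻¹ *ᵥ y) = y := by
    rw [Matrix.mulVec_mulVec,
      Matrix.mul_nonsing_inv _ (isUnit_iff_ne_zero.mpr (areaMatrix_det_ne_zero n)),
      Matrix.one_mulVec]
  rw [areaDensity_eq_indicator, Set.indicator_of_notMem, mul_zero]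
  intro (hnonneg : 0 ≤ (areaMatrix n)⁻¹ *ᵥ y)
  rw [← hy, areaMatrix_mulVec] at hk
  exact hk.not_ge (mul_nonneg (by positivity) (Finset.sum_nonneg fun i _ =>
    Finset.sum_nonneg fun j _ => hnonneg j))

theorem lintegral_areaDensity (n : ℕ) :
    ∫⁻ y, ENNReal.ofReal (areaDensity n y) = 1 := by
  have := isProbabilityMeasure_expMeasure one_pos
  have hmeas : Measurable fun x : Fin n → ℝ => areaMatrix n *ᵥ x :=
    (Matrix.toLin' (areaMatrix n)).continuous_of_finiteDimensional.measurable
  have hmap := map_normalizedArea (Measure.pi fun _ : Fin n => expMeasure 1) n (fun i x => x i)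
    measurable_pi_apply (fun i => (measurePreserving_eval _ i).map_eq)
    (iIndepFun_pi fun _ => aemeasurable_id)
  rw [← setLIntegral_univ, ← withDensity_apply _ MeasurableSet.univ, ← hmap,
    Measure.map_apply hmeas MeasurableSet.univ, Set.preimage_univ, measure_univ]

/-- The normalized areas `y` whose excess over the level `t`, measured by the areas
`triangular i * (y i - t)`, is `W`. -/
noncomputable def areaOfExcess (t : ℝ) (W : Fin n → ℝ) : Fin n → ℝ :=
  fun i => t + (triangular i)⁻¹ * W i

theorem le_areaOfExcess_iff {W : Fin n → ℝ} : (fun _ => t) ≤ areaOfExcess t W ↔ 0 ≤ W :=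
  forall_congr' fun i => by
    rw [areaOfExcess, le_add_iff_nonneg_right, Pi.zero_apply,
      mul_nonneg_iff_of_pos_left (inv_pos.mpr (triangular_pos i))]

theorem areaMatrix_inv_mulVec_areaOfExcess (t : ℝ) (W : Fin n → ℝ) (i : Fin n) :
    ((areaMatrix n)⁻¹ *ᵥ areaOfExcess t W) i = t + Δ_[1] (Δ_[1] (zeroPad n W)) i := by
  have hscale : (fun j : Fin n => triangular j * areaOfExcess t W j) =
      t • (fun j : Fin n => triangular j) + W := by
    ext j
    have hj := (triangular_pos j).ne'
    simp only [areaOfExcess, Pi.add_apply, Pi.smul_apply, smul_eq_mul]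
    field_simp
  rw [areaMatrix_inv_mulVec, hscale, map_add, map_smul, fwdDiff_add, fwdDiff_add,
    fwdDiff_const_smul, fwdDiff_const_smul, Pi.add_apply, Pi.smul_apply,
    fwdDiff_fwdDiff_zeroPad_triangular i.2, smul_eq_mul, mul_one]

theorem sum_areaMatrix_inv_mulVec_areaOfExcess (t : ℝ) (W : Fin n → ℝ) :
    ∑ i, ((areaMatrix n)⁻¹ *ᵥ areaOfExcess t W) i = n * t + Δ_[1] (zeroPad n W) n := by
  simp only [areaMatrix_inv_mulVec_areaOfExcess, Finset.sum_add_distrib, Finset.sum_const,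
    Finset.card_univ, Fintype.card_fin, nsmul_eq_mul]
  rw [Fin.sum_univ_eq_sum_range fun i => Δ_[1] (Δ_[1] (zeroPad n W)) i,
    sum_fwdDiff_fwdDiff_zeroPad]

/-- The density of the normalized areas on the event that all of them are at least `t`. -/
noncomputable def areaDensityAbove (n : ℕ) (t : ℝ) : (Fin n → ℝ) → ENNReal :=
  (Set.Ici fun _ => t).indicator fun y => ENNReal.ofReal (areaDensity n y)

theorem measurable_areaDensityAbove (n : ℕ) (t : ℝ) : Measurable (areaDensityAbove n t) :=
  (measurable_areaDensity n).ennreal_ofReal.indicator measurableSet_Ici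

/-- The density `areaDensityAbove n t` in the coordinates given by the excess areas, up to a
factor depending only on `n` and `t`. -/
noncomputable def excessDensity (n : ℕ) (t : ℝ) : (Fin n → ℝ) → ENNReal :=
  (semiconvexRegion n n t).indicator fun W => ENNReal.ofReal (Real.exp (-Δ_[1] (zeroPad n W) n))

theorem measurable_excessDensity (n : ℕ) (t : ℝ) : Measurable (excessDensity n t) := by
  refine Measurable.indicator ?_ (measurableSet_semiconvexRegion n n t)
  simp only [fwdDiff]
  fun_prop

theorem mem_semiconvexRegion_iff_areaOfExcess {W : Fin n → ℝ} :
    W ∈ semiconvexRegion n n t ↔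
      (fun _ => t) ≤ areaOfExcess t W ∧ 0 ≤ (areaMatrix n)⁻¹ *ᵥ areaOfExcess t W := by
  have hincr : 0 ≤ (areaMatrix n)⁻¹ *ᵥ areaOfExcess t W ↔
      ∀ j < n, -t ≤ Δ_[1] (Δ_[1] (zeroPad n W)) j := by
    simp only [Pi.le_def, areaMatrix_inv_mulVec_areaOfExcess, Pi.zero_apply, Fin.forall_iff,
      neg_le_iff_add_nonneg']
  rw [le_areaOfExcess_iff, hincr]
  rfl

theorem areaDensityAbove_areaOfExcess (t : ℝ) (W : Fin n → ℝ) :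
    areaDensityAbove n t (areaOfExcess t W) =
      ENNReal.ofReal ((∏ i : Fin n, triangular i) * Real.exp (-(n * t))) *
        excessDensity n t W := by
  have hmem := mem_semiconvexRegion_iff_areaOfExcess (t := t) (W := W)
  have hprod := (prod_triangular_pos fun i : Fin n => (i : ℕ)).le
  by_cases habove : (fun _ => t) ≤ areaOfExcess t W
  · rw [areaDensityAbove, Set.indicator_of_mem (Set.mem_Ici.mpr habove), areaDensity_eq_indicator]
    by_cases hincr : 0 ≤ (areaMatrix n)⁻¹ *ᵥ areaOfExcess t W
    · rw [Set.indicator_of_mem (Set.mem_Ici.mpr hincr), sum_areaMatrix_inv_mulVec_areaOfExcess,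
        excessDensity, Set.indicator_of_mem (hmem.mpr ⟨habove, hincr⟩), neg_add, Real.exp_add,
        ← mul_assoc, ENNReal.ofReal_mul (by positivity)]
    · rw [Set.indicator_of_notMem (by exact hincr), excessDensity,
        Set.indicator_of_notMem fun h => hincr (hmem.mp h).2, mul_zero, mul_zero,
        ENNReal.ofReal_zero]
  · rw [areaDensityAbove, Set.indicator_of_notMem (by exact habove), excessDensity,
      Set.indicator_of_notMem fun h => habove (hmem.mp h).1, mul_zero]

theorem lintegral_comp_add_mul {ι : Type*} [Fintype ι] (a : ι → ℝ) {D : ι → ℝ}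
    (hD : ∏ i, D i ≠ 0) {F : (ι → ℝ) → ENNReal} (hF : Measurable F) :
    ENNReal.ofReal |∏ i, D i| * ∫⁻ z : ι → ℝ, F (fun i => a i + D i * z i) = ∫⁻ z, F z := by
  classical
  have hmap := Real.smul_map_diagonal_volume_pi (D := D) (by rwa [det_diagonal])
  have hmeas := (Matrix.toLin' (diagonal D)).continuous_of_finiteDimensional.measurable
  rw [det_diagonal] at hmap
  have hdiag (z : ι → ℝ) : (fun i => a i + D i * z i) = a + Matrix.toLin' (diagonal D) z := by
    ext i
    simp [mulVec_diagonal]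
  simp only [hdiag]
  rw [← lintegral_map (f := fun z => F (a + z)) (hF.comp (measurable_const_add a)) hmeas,
    ← smul_eq_mul, ← lintegral_smul_measure, hmap, lintegral_add_left_eq_self]

theorem lintegral_excessDensity_lt_top (n : ℕ) (t : ℝ) : ∫⁻ W, excessDensity n t W < ⊤ := by
  have hprod := prod_triangular_pos fun i : Fin n => (i : ℕ)
  have habove : ∫⁻ y, areaDensityAbove n t y ≤ 1 :=
    (lintegral_mono fun y => Set.indicator_le_self _ _ y).trans_eq (lintegral_areaDensity n)
  have hinv : ∏ i : Fin n, (triangular i)⁻¹ ≠ 0 := by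
    rw [Finset.prod_inv_distrib]
    exact (inv_pos.mpr hprod).ne'
  rw [← lintegral_comp_add_mul (fun _ => t) hinv (measurable_areaDensityAbove n t)] at habove
  simp only [← areaOfExcess.eq_1, areaDensityAbove_areaOfExcess] at habove
  rw [lintegral_const_mul _ (measurable_excessDensity n t)] at habove
  have hscaled := ENNReal.lt_top_of_mul_ne_top_right (habove.trans_lt ENNReal.one_lt_top).ne
    (by simpa using hinv)
  exact ENNReal.lt_top_of_mul_ne_top_right hscaled.ne (by simpa using by positivity)

end AreaDensity

section Glue

variable {a b : ℕ}

theorem zeroPad_append_left {R : Type*} [CommRing R] (u : Fin a → R) (w : Fin b → R) {j : ℕ}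
    (hj : j < a + 2) : zeroPad (a + b) (Fin.append u w) j = zeroPad a u j := by
  match j with
  | 0 | 1 => simp
  | j + 2 =>
    have hja : j < a := Nat.add_lt_add_iff_right.mp hj
    rw [zeroPad_add_two _ (Nat.lt_add_right b hja), zeroPad_add_two _ hja]
    exact Fin.append_left u w ⟨j, hja⟩

theorem zeroPad_append_right {R : Type*} [CommRing R] (u : Fin a → R) (w : Fin b → R) (j : ℕ) :
    zeroPad (a + b) (Fin.append u w) (a + (j + 2)) = zeroPad b w (j + 2) := by
  rcases lt_or_ge j b with hj | hj
  · rw [← add_assoc, zeroPad_add_two _ (Nat.add_lt_add_left hj a), zeroPad_add_two _ hj]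
    exact Fin.append_right u w ⟨j, hj⟩
  · rw [zeroPad_of_add_two_le _ (by omega), zeroPad_of_add_two_le _ (by omega)]

theorem zeroPad_snoc_zero {R : Type*} [CommRing R] (u : Fin a → R) (j : ℕ) :
    zeroPad (a + 1) (Fin.snoc u 0 : Fin (a + 1) → R) j = zeroPad a u j := by
  match j with
  | 0 | 1 => simp
  | j + 2 =>
    rcases lt_trichotomy j a with hj | rfl | hj
    · rw [zeroPad_add_two _ (Nat.lt_add_right 1 hj), zeroPad_add_two _ hj]
      exact Fin.snoc_castSucc (α := fun _ => R) 0 u ⟨j, hj⟩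
    · rw [zeroPad_add_two _ j.lt_succ_self, zeroPad_of_add_two_le _ le_rfl]
      exact Fin.snoc_last (α := fun _ => R) 0 u
    · rw [zeroPad_of_add_two_le _ (by omega), zeroPad_of_add_two_le _ (by omega)]

/-- The tuple `u 0, …, u (a - 1), 0, w 0, …, w (b - 1)`. -/
def glue (u : Fin a → ℝ) (w : Fin b → ℝ) : Fin (a + 1 + b) → ℝ :=
  Fin.append (Fin.snoc u 0 : Fin (a + 1) → ℝ) w

variable {u : Fin a → ℝ} {w : Fin b → ℝ}

theorem zeroPad_glue_left {j : ℕ} (hj : j ≤ a + 2) :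
    zeroPad (a + 1 + b) (glue u w) j = zeroPad a u j := by
  rw [glue, zeroPad_append_left _ _ (by omega), zeroPad_snoc_zero]

theorem zeroPad_glue_right (j : ℕ) :
    zeroPad (a + 1 + b) (glue u w) (a + 1 + (j + 1)) = zeroPad b w (j + 1) := by
  match j with
  | 0 => rw [zeroPad_glue_left le_rfl, zeroPad_of_add_two_le _ le_rfl, zeroPad_one]
  | j + 1 => rw [glue, zeroPad_append_right]

theorem glue_nonneg_iff : 0 ≤ glue u w ↔ 0 ≤ u ∧ 0 ≤ w := by
  simp [glue, Pi.le_def, Fin.forall_fin_add, Fin.forall_fin_succ']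

theorem fwdDiff_fwdDiff_zeroPad_glue_left {j : ℕ} (hj : j ≤ a) :
    Δ_[1] (Δ_[1] (zeroPad (a + 1 + b) (glue u w))) j = Δ_[1] (Δ_[1] (zeroPad a u)) j := by
  simp only [fwdDiff_fwdDiff_one_apply]
  rw [zeroPad_glue_left (by omega), zeroPad_glue_left (by omega), zeroPad_glue_left (by omega)]

theorem fwdDiff_fwdDiff_zeroPad_glue_right (j : ℕ) :
    Δ_[1] (Δ_[1] (zeroPad (a + 1 + b) (glue u w))) (a + 1 + (j + 1)) =
      Δ_[1] (Δ_[1] (zeroPad b w)) (j + 1) := by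
  simp only [fwdDiff_fwdDiff_one_apply]
  rw [add_assoc (a + 1) (j + 1) 2, add_assoc (a + 1) (j + 1) 1, add_right_comm j 1 2,
    zeroPad_glue_right, zeroPad_glue_right, zeroPad_glue_right]

theorem fwdDiff_fwdDiff_nonneg_of_eq_zero {f : ℕ → ℝ} {j : ℕ} (hf : 0 ≤ f) (hj : f (j + 1) = 0) :
    0 ≤ Δ_[1] (Δ_[1] f) j := by
  rw [fwdDiff_fwdDiff_one_apply, hj, mul_zero, sub_zero]
  exact add_nonneg (hf _) (hf _)

-- The glued sequence vanishes at `a + 2`, so the one second difference that involves both `u`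
-- and `w`, the one centred there, is automatically nonnegative. So is the first one of `w`.
theorem glue_mem_semiconvexRegion_iff {t : ℝ} (ht : 0 ≤ t) :
    glue u w ∈ semiconvexRegion (a + 1 + b) (a + 1 + b) t ↔
      u ∈ semiconvexRegion a (a + 1) t ∧ w ∈ semiconvexRegion b b t := by
  have hneg {x : ℝ} (hx : 0 ≤ x) : -t ≤ x := (neg_nonpos.mpr ht).trans hx
  constructor
  · rintro ⟨hnonneg, hdiff⟩
    obtain ⟨hu, hw⟩ := glue_nonneg_iff.mp hnonneg
    refine ⟨⟨hu, fun j hj => ?_⟩, hw, fun j hj => ?_⟩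
    · rw [← fwdDiff_fwdDiff_zeroPad_glue_left (w := w) (Nat.lt_succ_iff.mp hj)]
      exact hdiff j (Nat.lt_add_right b hj)
    · rcases j with _ | j
      · exact hneg (fwdDiff_fwdDiff_nonneg_of_eq_zero (zeroPad_nonneg hw) (zeroPad_one w))
      · rw [← fwdDiff_fwdDiff_zeroPad_glue_right (u := u)]
        exact hdiff _ (Nat.add_lt_add_left hj _)
  · rintro ⟨⟨hu, hudiff⟩, hw, hwdiff⟩
    have hnonneg := glue_nonneg_iff.mpr ⟨hu, hw⟩
    refine ⟨hnonneg, fun j hj => ?_⟩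
    rcases lt_or_ge j (a + 1) with hja | hja
    · rw [fwdDiff_fwdDiff_zeroPad_glue_left (Nat.lt_succ_iff.mp hja)]
      exact hudiff j hja
    · obtain ⟨j, rfl⟩ := Nat.exists_eq_add_of_le hja
      rcases j with _ | j
      · have hzero : zeroPad (a + 1 + b) (glue u w) (a + 1 + 0 + 1) = 0 := by
          rw [zeroPad_glue_left le_rfl, zeroPad_of_add_two_le _ le_rfl]
        exact hneg (fwdDiff_fwdDiff_nonneg_of_eq_zero (zeroPad_nonneg hnonneg) hzero)
      · rw [fwdDiff_fwdDiff_zeroPad_glue_right]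
        exact hwdiff _ (Nat.add_lt_add_iff_left.mp hj)

theorem excessDensity_glue (hb : 0 < b) {t : ℝ} (ht : 0 ≤ t) :
    excessDensity (a + 1 + b) t (glue u w) =
      (semiconvexRegion a (a + 1) t).indicator 1 u * excessDensity b t w := by
  obtain ⟨b, rfl⟩ := Nat.exists_eq_add_one.mpr hb
  have hlast : Δ_[1] (zeroPad (a + 1 + (b + 1)) (glue u w)) (a + 1 + (b + 1)) =
      Δ_[1] (zeroPad (b + 1) w) (b + 1) := by
    rw [fwdDiff, fwdDiff, add_assoc (a + 1), zeroPad_glue_right, zeroPad_glue_right]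
  have hmem := glue_mem_semiconvexRegion_iff (u := u) (w := w) ht
  rw [excessDensity, excessDensity]
  by_cases hu : u ∈ semiconvexRegion a (a + 1) t
  · by_cases hw : w ∈ semiconvexRegion (b + 1) (b + 1) t
    · rw [Set.indicator_of_mem (hmem.mpr ⟨hu, hw⟩), Set.indicator_of_mem hu,
        Set.indicator_of_mem hw, Pi.one_apply, one_mul, hlast]
    · rw [Set.indicator_of_notMem fun h => hw (hmem.mp h).2, Set.indicator_of_notMem hw, mul_zero]
  · rw [Set.indicator_of_notMem fun h => hu (hmem.mp h).1, Set.indicator_of_notMem hu, zero_mul]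

end Glue

section Slice

variable {a b : ℕ} {t : ℝ}

/-- The coordinates of the hyperplane `y_{a + 1} = t` are the first `a` and the last `b` ones. -/
noncomputable def sliceCoordEquiv (a b : ℕ) : Fin a ⊕ Fin b ≃ SliceCoord (a + 1 + b) (a + 1) := by
  let coord : Fin a ⊕ Fin b → SliceCoord (a + 1 + b) (a + 1) :=
    Sum.elim (fun i => ⟨Fin.castAdd b i.castSucc, fun h => i.2.ne (Nat.succ_injective h)⟩)
      fun j => ⟨Fin.natAdd (a + 1) j, by rw [Fin.val_natAdd]; omega⟩
  refine Equiv.ofBijective coord ⟨?_, ?_⟩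
  · rintro (i | i) (j | j) hij <;>
      have hval : (_ : ℕ) = _ := congrArg (fun s => (s.1 : ℕ)) hij <;>
      simp only [coord, Sum.elim_inl, Sum.elim_inr, Fin.val_castAdd, Fin.val_castSucc,
        Fin.val_natAdd] at hval
    · exact congrArg Sum.inl (Fin.ext hval)
    · omega
    · omega
    · exact congrArg Sum.inr (Fin.ext (Nat.add_left_cancel hval))
  · rintro ⟨i, hi⟩
    induction i using Fin.addCases with
    | left i =>
      induction i using Fin.lastCases with
      | last => exact absurd rfl hi
      | cast i => exact ⟨.inl i, rfl⟩
    | right j => exact ⟨.inr j, rfl⟩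

theorem lintegral_sliceCoord (F : (SliceCoord (a + 1 + b) (a + 1) → ℝ) → ENNReal) :
    ∫⁻ z, F z = ∫⁻ p : (Fin a → ℝ) × (Fin b → ℝ), F fun s => glue p.1 p.2 s.1 := by
  let e := (MeasurableEquiv.sumPiEquivProdPi fun _ : Fin a ⊕ Fin b => ℝ).symm.trans
    (MeasurableEquiv.piCongrLeft (fun _ => ℝ) (sliceCoordEquiv a b))
  have he : MeasurePreserving e volume volume :=
    (volume_measurePreserving_piCongrLeft (fun _ => ℝ) (sliceCoordEquiv a b)).comp
      (volume_measurePreserving_sumPiEquivProdPi_symm fun _ : Fin a ⊕ Fin b => ℝ)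
  rw [← he.lintegral_comp_emb e.measurableEmbedding]
  refine lintegral_congr fun p => congrArg F (funext fun s => ?_)
  obtain ⟨i | j, rfl⟩ := (sliceCoordEquiv a b).surjective s
  · calc e p (sliceCoordEquiv a b (Sum.inl i)) = p.1 i :=
          Equiv.piCongrLeft_sumInl (fun _ => ℝ) (sliceCoordEquiv a b) p.1 p.2 i
      _ = glue p.1 p.2 (Fin.castAdd b i.castSucc) := by
          rw [glue, Fin.append_left, Fin.snoc_castSucc]
  · calc e p (sliceCoordEquiv a b (Sum.inr j)) = p.2 j :=
          Equiv.piCongrLeft_sumInr (fun _ => ℝ) (sliceCoordEquiv a b) p.1 p.2 j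
      _ = glue p.1 p.2 (Fin.natAdd (a + 1) j) := by rw [glue, Fin.append_right]

theorem prod_sliceCoord {M : Type*} [CommMonoid M] (F : ℕ → M) :
    F a * ∏ s : SliceCoord (a + 1 + b) (a + 1), F s.1 = ∏ i : Fin (a + 1 + b), F i := by
  rw [← Finset.mul_prod_erase Finset.univ _ (Finset.mem_univ (⟨a, by omega⟩ : Fin (a + 1 + b)))]
  congr 1
  refine (Finset.prod_subtype _ (fun i => ?_) fun i : Fin (a + 1 + b) => F i).symm
  simp [Fin.ext_iff]

theorem measurable_slicePoint (n k : ℕ) (t : ℝ) : Measurable (slicePoint n k t) := by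
  refine measurable_pi_lambda _ fun i => ?_
  simp only [slicePoint]
  split_ifs
  exacts [measurable_pi_apply _, measurable_const]

theorem slicePoint_areaOfExcess_glue (t : ℝ) (u : Fin a → ℝ) (w : Fin b → ℝ) :
    (slicePoint (a + 1 + b) (a + 1) t fun s => areaOfExcess t (glue u w) s.1) =
      areaOfExcess t (glue u w) := by
  ext i
  rw [slicePoint]
  split_ifs with hi
  · rfl
  · have hia : i = Fin.castAdd b (Fin.last a) := Fin.ext (by simpa using hi)
    rw [areaOfExcess, hia, glue, Fin.append_left, Fin.snoc_last, mul_zero, add_zero]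

theorem setLIntegral_sliceSet (n k : ℕ) (t : ℝ) :
    ∫⁻ z in sliceSet n k t, ENNReal.ofReal (areaDensity n (slicePoint n k t z)) =
      ∫⁻ z, areaDensityAbove n t (slicePoint n k t z) :=
  (lintegral_indicator (measurable_slicePoint n k t measurableSet_Ici) _).symm

theorem lintegral_excessDensity_glue (hb : 0 < b) (ht : 0 ≤ t) :
    ∫⁻ p : (Fin a → ℝ) × (Fin b → ℝ), excessDensity (a + 1 + b) t (glue p.1 p.2) =
      volume (semiconvexRegion a (a + 1) t) * ∫⁻ w, excessDensity b t w := by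
  have hregion := measurableSet_semiconvexRegion a (a + 1) t
  simp only [excessDensity_glue hb ht]
  rw [Measure.volume_eq_prod, lintegral_prod_mul (measurable_one.indicator hregion).aemeasurable
    (measurable_excessDensity b t).aemeasurable, lintegral_indicator_one hregion]

theorem lintegral_areaDensityAbove_slicePoint (a b : ℕ) (t : ℝ) :
    ∫⁻ z, areaDensityAbove (a + 1 + b) t (slicePoint (a + 1 + b) (a + 1) t z) =
      ENNReal.ofReal (∏ s : SliceCoord (a + 1 + b) (a + 1), triangular s.1)⁻¹ *
        ∫⁻ p : (Fin a → ℝ) × (Fin b → ℝ),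
          areaDensityAbove (a + 1 + b) t (areaOfExcess t (glue p.1 p.2)) := by
  have hslice : Measurable fun z =>
      areaDensityAbove (a + 1 + b) t (slicePoint (a + 1 + b) (a + 1) t z) :=
    (measurable_areaDensityAbove _ _).comp (measurable_slicePoint _ _ _)
  have hprod := inv_pos.mpr
    (prod_triangular_pos fun s : SliceCoord (a + 1 + b) (a + 1) => (s.1 : ℕ))
  rw [← Finset.prod_inv_distrib] at hprod ⊢
  rw [← lintegral_comp_add_mul (fun _ => t) hprod.ne' hslice, abs_of_pos hprod,
    lintegral_sliceCoord]
  exact congrArg _ (lintegral_congr fun p => congrArg _ (slicePoint_areaOfExcess_glue t p.1 p.2))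

theorem lintegral_slice (hb : 0 < b) (ht : 0 ≤ t) :
    ∫⁻ z in sliceSet (a + 1 + b) (a + 1) t,
        ENNReal.ofReal (areaDensity (a + 1 + b) (slicePoint (a + 1 + b) (a + 1) t z)) =
      ENNReal.ofReal (triangular a * Real.exp (-((a + 1 + b : ℕ) * t))) *
        (volume (semiconvexRegion a (a + 1) t) * ∫⁻ w, excessDensity b t w) := by
  have hprod := prod_triangular_pos fun s : SliceCoord (a + 1 + b) (a + 1) => (s.1 : ℕ)
  simp only [setLIntegral_sliceSet, lintegral_areaDensityAbove_slicePoint,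
    areaDensityAbove_areaOfExcess]
  rw [lintegral_const_mul' _ _ ENNReal.ofReal_ne_top, lintegral_excessDensity_glue hb ht,
    ← mul_assoc, ← ENNReal.ofReal_mul (by positivity), ← prod_sliceCoord triangular]
  congr 2
  field_simp

theorem partialDensity_eq_toReal (n k : ℕ) (t : ℝ) :
    partialDensity n k t = (∫⁻ z in sliceSet n k t,
      ENNReal.ofReal (areaDensity n (slicePoint n k t z))).toReal := by
  rw [partialDensity, integral_eq_lintegral_of_nonneg_ae]
  · exact .of_forall fun z => areaDensity_nonneg _
  · exact ((measurable_areaDensity n).comp (measurable_slicePoint n k t)).aestronglyMeasurable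

theorem areaDensity_slicePoint_of_neg (ht : t < 0) (z : SliceCoord (a + 1 + b) (a + 1) → ℝ) :
    areaDensity (a + 1 + b) (slicePoint (a + 1 + b) (a + 1) t z) = 0 :=
  areaDensity_of_neg (k := ⟨a, by omega⟩) (by simpa [slicePoint] using ht)

theorem integrableOn_areaDensity_slicePoint (hb : 0 < b) (t : ℝ) :
    IntegrableOn (fun z => areaDensity (a + 1 + b) (slicePoint (a + 1 + b) (a + 1) t z))
      (sliceSet (a + 1 + b) (a + 1) t) := by
  rcases lt_or_ge t 0 with ht | ht
  · simp only [areaDensity_slicePoint_of_neg ht]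
    exact integrableOn_zero
  · have hmeas := (measurable_areaDensity (a + 1 + b)).comp (measurable_slicePoint _ (a + 1) t)
    refine ⟨hmeas.aestronglyMeasurable, ?_⟩
    rw [hasFiniteIntegral_iff_ofReal (.of_forall fun z => areaDensity_nonneg _),
      lintegral_slice hb ht]
    exact ENNReal.mul_lt_top ENNReal.ofReal_lt_top (ENNReal.mul_lt_top
      (volume_semiconvexRegion_ne_top a ht).lt_top (lintegral_excessDensity_lt_top b t))

theorem partialDensity_eq_mul (hb : 0 < b) (ht : 0 ≤ t) :
    partialDensity (a + 1 + b) (a + 1) t =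
      triangular a * (volume (semiconvexRegion a (a + 1) 1)).toReal * t ^ a *
        Real.exp (-((a + 1 + b : ℕ) * t)) * (∫⁻ w, excessDensity b t w).toReal := by
  have ha := triangular_pos a
  rw [partialDensity_eq_toReal, lintegral_slice hb ht, volume_semiconvexRegion a ht,
    ENNReal.toReal_mul, ENNReal.toReal_mul, ENNReal.toReal_mul,
    ENNReal.toReal_ofReal (by positivity), ENNReal.toReal_ofReal (by positivity)]
  ring

end Slice

section SliceConst

/-- The constant `c_k` of the factorization. Given that the `k`-th normalized area equals `1`, the
excess areas over the level `1` at the first `k - 1` times range over the region whose volume occurs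
here, and `triangular (k - 1)` is the scale of the missing `k`-th coordinate. -/
noncomputable def sliceConst (k : ℕ) : ℝ :=
  triangular (k - 1) * (volume (semiconvexRegion (k - 1) k 1)).toReal

theorem sliceConst_add_one (a : ℕ) :
    sliceConst (a + 1) = triangular a * (volume (semiconvexRegion a (a + 1) 1)).toReal := rfl

theorem sliceConst_one : sliceConst 1 = 1 := by
  rw [sliceConst_add_one, semiconvexRegion_zero _ zero_le_one]
  simp [triangular, volume_pi]

theorem sliceConst_pos {k : ℕ} (hk : 1 ≤ k) : 0 < sliceConst k := by
  obtain ⟨a, rfl⟩ := Nat.exists_eq_add_one.mpr hk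
  exact mul_pos (triangular_pos a) (ENNReal.toReal_pos (volume_semiconvexRegion_pos _ _ one_pos).ne'
    (volume_semiconvexRegion_ne_top a zero_le_one))

theorem partialDensity_eq_sliceConst_mul {a b : ℕ} (hb : 0 < b) (t : ℝ) :
    partialDensity (a + 1 + b) (a + 1) t =
      sliceConst (a + 1) * (t * Real.exp (-t)) ^ a * partialDensity (0 + 1 + b) (0 + 1) t := by
  rcases lt_or_ge t 0 with ht | ht
  · simp only [partialDensity, areaDensity_slicePoint_of_neg ht, integral_zero, mul_zero]
  · have hexp : Real.exp (-((a + 1 + b : ℕ) * t)) =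
        Real.exp (-t) ^ a * Real.exp (-((0 + 1 + b : ℕ) * t)) := by
      rw [← Real.exp_nat_mul, ← Real.exp_add]
      push_cast
      ring_nf
    rw [partialDensity_eq_mul hb ht, partialDensity_eq_mul hb ht, ← sliceConst_add_one,
      ← sliceConst_add_one, zero_add, sliceConst_one, hexp, mul_pow]
    ring

theorem sliceConst_le_pow_div_factorial {k : ℕ} (hk : 1 ≤ k) :
    sliceConst k ≤ k ^ (k + 1) / k.factorial := by
  obtain ⟨a, rfl⟩ := Nat.exists_eq_add_one.mpr hk
  have hvol := ENNReal.toReal_mono ENNReal.ofReal_ne_top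
    (volume_semiconvexRegion_le a zero_le_one)
  rw [ENNReal.toReal_ofReal (by positivity), mul_one] at hvol
  have htri : triangular a ≤ ((a + 1 : ℕ) : ℝ) ^ 2 := by
    rw [triangular]
    push_cast
    nlinarith [a.cast_nonneg (α := ℝ)]
  calc sliceConst (a + 1)
      ≤ ((a + 1 : ℕ) : ℝ) ^ 2 * ((a : ℝ) ^ a / (a + 1).factorial) :=
        mul_le_mul htri hvol ENNReal.toReal_nonneg (by positivity)
    _ ≤ ((a + 1 : ℕ) : ℝ) ^ 2 * (((a + 1 : ℕ) : ℝ) ^ a / (a + 1).factorial) := by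
        gcongr
        exact a.le_succ
    _ = ((a + 1 : ℕ) : ℝ) ^ (a + 1 + 1) / (a + 1).factorial := by ring

theorem pow_self_div_factorial_le {n : ℕ} (hn : 1 ≤ n) :
    (n : ℝ) ^ n / n.factorial ≤ Real.exp n / √n := by
  have hn' : (0 : ℝ) < n := Nat.cast_pos.mpr hn
  have hsqrt : √(n : ℝ) ≤ √(2 * Real.pi * n) :=
    Real.sqrt_le_sqrt (le_mul_of_one_le_left hn'.le (by linarith [Real.pi_gt_three]))
  have hstirling := (mul_le_mul_of_nonneg_right hsqrt (by positivity)).trans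
    (Stirling.le_factorial_stirling n)
  rw [div_pow, ← Real.exp_nat_mul, mul_one, mul_div_assoc', div_le_iff₀ (Real.exp_pos _)]
    at hstirling
  rw [div_le_div_iff₀ (by positivity) (by positivity)]
  linarith

theorem sliceConst_le_sqrt_mul_exp {k : ℕ} (hk : 1 ≤ k) :
    sliceConst k ≤ √k * Real.exp k := by
  calc sliceConst k ≤ k ^ (k + 1) / k.factorial := sliceConst_le_pow_div_factorial hk
    _ = k * (k ^ k / k.factorial) := by ring
    _ ≤ k * (Real.exp k / √k) :=
        mul_le_mul_of_nonneg_left (pow_self_div_factorial_le hk) k.cast_nonneg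
    _ = √k * Real.exp k := by rw [mul_div_left_comm, Real.div_sqrt, mul_comm]

theorem isBigO_sliceConst :
    sliceConst =O[Filter.atTop] fun k : ℕ => Real.sqrt k * Real.exp k := by
  refine .of_norm_eventuallyLE ?_
  filter_upwards [Filter.eventually_ge_atTop 1] with k hk
  rw [Real.norm_of_nonneg (sliceConst_pos hk).le]
  exact sliceConst_le_sqrt_mul_exp hk

end SliceConst

theorem lemma2 :
    ∃ c : ℕ → ℝ,
      (∀ k : ℕ, 1 ≤ k → 0 < c k) ∧
      (∀ n k : ℕ, 2 ≤ n → 1 ≤ k → k ≤ n - 1 → ∀ t : ℝ,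
        IntegrableOn (fun z => areaDensity n (slicePoint n k t z)) (sliceSet n k t) ∧
        partialDensity n k t =
          c k * (t * Real.exp (-t)) ^ (k - 1) * partialDensity (n - k + 1) 1 t) ∧
      c =O[Filter.atTop] fun k : ℕ => Real.sqrt k * Real.exp k := by
  refine ⟨sliceConst, fun k => sliceConst_pos, fun n k _ hk hkn t => ?_, isBigO_sliceConst⟩
  obtain ⟨a, rfl⟩ := Nat.exists_eq_add_one.mpr hk
  obtain ⟨b, rfl⟩ : ∃ b, n = a + 1 + b := Nat.exists_eq_add_of_le (by omega)
  have hb : 0 < b := by omega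
  refine ⟨integrableOn_areaDensity_slicePoint hb t, ?_⟩
  rw [Nat.add_sub_cancel, show a + 1 + b - (a + 1) + 1 = 0 + 1 + b by omega]
  exact partialDensity_eq_sliceConst_mul hb t
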